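/- Let $(\Omega,\mathcal F,P)$ be a probability space, $L^0=L^0(\mathcal F,\mathbb R)$ the algebra of equivalence classes (modulo a.s. equality) of real random variables, $\bar L^0$ the set of equivalence classes of extended real-valued random variables, both ordered almost surely, and $L^0_{++}=\{\varepsilon\in L^0:\varepsilon>0 \text{ a.s.}\}$. Give $L^0$ the topology $\mathcal T_c$ in which $G$ is open iff for each $x\in G$ there is $\varepsilon\in L^0_{++}$ with $x+\{\eta\in L^0:|\eta|\le\varepsilon\}\subset G$. Let $E$ be an $L^0$-module with a topology $\mathcal T$. As usual, $\tilde I_A\in L^0$ is the class of the indicator of $A\in\mathcal F$, and it is assumed that $x=y$ whenever $x,y\in E$ and $\tilde I_{A_n}x=\tilde I_{A_n}y$ for all $n$, for some countable measurable partition $(A_n)_{n\in\mathbb N}$ of $\Omega$. A set $B\subset E$ is called $L^0$-balanced if $\eta x\in B$ for all $x\in B$, $\eta\in L^0$ with $|\eta|\le 1$; $L^0$-absorbent if for every $x\in E$ there is $\xi\in L^0_{++}$ with $\eta x\in B$ for all $\eta\in L^0$ with $|\eta|\le\xi$; $L^0$-convex if $\xi x+(1-\xi)y\in B$ for all $x,y\in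 B$ and $\xi\in L^0$ with $0\le\xi\le1$. It has the countable concatenation property if for every sequence $(x_n)$ in $B$ and every countable measurable partition $(A_n)$ of $\Omega$ there is $x\in B$ with $\tilde I_{A_n}x=\tilde I_{A_n}x_n$ for all $n$. The module $(E,\mathcal T)$ is locally $L^0$-convex if addition $E\times E\to E$ and multiplication $(L^0,\mathcal T_c)\times E\to E$ are jointly continuous and $0$ has a local base of $L^0$-balanced, $L^0$-absorbent, $L^0$-convex sets. It is $L^0$-pre-barreled if it is locally $L^0$-convex and every closed, $L^0$-balanced, $L^0$-absorbent, $L^0$-convex subset of $E$ with the countable concatenation property is a neighborhood of $0$. For $f:E\to\bar L^0$ let $\operatorname{dom}(f)=\{x\in E:|f(x)|<+\infty\text{ a.s.}\}$. The function $f$ is proper if $\operatorname{dom}(f)\ne\emptyset$ and $f(x)>-\infty$ a.s. for all $x\in E$; it is $L^0$-convex if $f(\xi x+(1-\xi)y)\le\xi f(x)+(1-\xi)f(y)$ for all $x,y\in E$ and $\xi\in L^0$ with $0\le\xi\le1$, where $0\cdot(\pm\infty)=0$ and $+\infty\pm(\pm\infty)=+\infty$; a proper $f$ is lower semicontinuous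 if $\{x\in E:f(x)\le r\}$ is closed for every $r\in L^0$. Let $E^*_c$ be the set of continuous $L^0$-module homomorphisms from $(E,\mathcal T)$ to $(L^0,\mathcal T_c)$, and for $x\in\operatorname{dom}(f)$ let $\partial f(x)=\{u\in E^*_c: u(y-x)\le f(y)-f(x)\text{ for all }y\in E\}$. Theorem 3.45. Let $(E,\mathcal T)$ be an $L^0$-pre-barreled module (over $L^0=L^0(\mathcal F,\mathbb R)$) such that $E$ has the countable concatenation property, and let $f:E\to\bar L^0$ be a proper lower semicontinuous $L^0$-convex function. Then $\partial f(x)\neq\emptyset$ for every $x$ in the $\mathcal T$-interior of $\operatorname{dom}(f)$. -/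

import Mathlib

open MeasureTheory Set Topology

noncomputable section

namespace RandomConvex

variable {Ω : Type*} [MeasurableSpace Ω]

/-- The algebra of equivalence classes of real-valued random variables on `(Ω, P)`. -/
abbrev L0 (P : Measure Ω) : Type _ := Ω →ₘ[P] ℝ

/-- The equivalence classes of extended real-valued random variables on `(Ω, P)`. -/
abbrev L0bar (P : Measure Ω) : Type _ := Ω →ₘ[P] EReal

/-- The ring structure of `L0 P`, on top of the additive and multiplicative structures that
`AEEqFun` carries. -/
instance commRingL0 (P : Measure Ω) : CommRing (L0 P) where
  __ := (inferInstance : AddCommGroup (L0 P))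
  __ := (inferInstance : CommMonoid (L0 P))
  left_distrib a b c := by
    refine AEEqFun.induction_on₃ a b c fun f _ g _ h _ => ?_
    simp only [AEEqFun.mk_add_mk, AEEqFun.mk_mul_mk, mul_add]
  right_distrib a b c := by
    refine AEEqFun.induction_on₃ a b c fun f _ g _ h _ => ?_
    simp only [AEEqFun.mk_add_mk, AEEqFun.mk_mul_mk, add_mul]
  zero_mul a := by
    refine AEEqFun.induction_on a fun f _ => ?_
    simp only [AEEqFun.zero_def, AEEqFun.mk_mul_mk]
    congr 1
    ext ω
    simp
  mul_zero a := by
    refine AEEqFun.induction_on a fun f _ => ?_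
    simp only [AEEqFun.zero_def, AEEqFun.mk_mul_mk]
    congr 1
    ext ω
    simp

/-- The set of all `ξ` in `L0 P` with `ξ > 0` almost surely on the whole of `Ω`. -/
def L0pp (P : Measure Ω) : Set (L0 P) := {ξ | ∀ᵐ ω ∂P, 0 < ξ ω}

/-- The equivalence class of the characteristic function of a measurable set. -/
def ind (P : Measure Ω) {A : Set Ω} (hA : MeasurableSet A) : L0 P :=
  AEEqFun.mk (A.indicator fun _ => (1 : ℝ))
    (stronglyMeasurable_const.indicator hA).aestronglyMeasurable

theorem inf_mem_L0pp {P : Measure Ω} {ε δ : L0 P} (hε : ε ∈ L0pp P) (hδ : δ ∈ L0pp P) :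
    ε ⊓ δ ∈ L0pp P := by
  have h1 : ∀ᵐ ω ∂P, 0 < ε ω := hε
  have h2 : ∀ᵐ ω ∂P, 0 < δ ω := hδ
  show ∀ᵐ ω ∂P, 0 < (ε ⊓ δ) ω
  filter_upwards [h1, h2, AEEqFun.coeFn_inf ε δ] with ω a b c
  rw [c]
  exact lt_min a b

theorem one_mem_L0pp (P : Measure Ω) : (1 : L0 P) ∈ L0pp P := by
  show ∀ᵐ ω ∂P, 0 < (1 : L0 P) ω
  filter_upwards [AEEqFun.coeFn_one (μ := P) (β := ℝ)] with ω h
  rw [h]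
  exact one_pos

/-- The topology `𝒯_c` on `L0 P`: a set `G` is open if for every `x ∈ G` there is some
`ε ∈ L0pp P` with `x + {η | |η| ≤ ε} ⊆ G`. -/
instance topologyC (P : Measure Ω) : TopologicalSpace (L0 P) where
  IsOpen G := ∀ x ∈ G, ∃ ε ∈ L0pp P, ∀ η : L0 P, |η| ≤ ε → x + η ∈ G
  isOpen_univ := fun _ _ => ⟨1, one_mem_L0pp P, fun _ _ => mem_univ _⟩
  isOpen_inter := by
    rintro G H hG hH x ⟨hxG, hxH⟩
    obtain ⟨ε, hε, h1⟩ := hG x hxG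
    obtain ⟨δ, hδ, h2⟩ := hH x hxH
    exact ⟨ε ⊓ δ, inf_mem_L0pp hε hδ, fun η hη =>
      ⟨h1 η (hη.trans inf_le_left), h2 η (hη.trans inf_le_right)⟩⟩
  isOpen_sUnion := by
    rintro S hS x ⟨G, hGS, hxG⟩
    obtain ⟨ε, hε, h⟩ := hS G hGS x hxG
    exact ⟨ε, hε, fun η hη => ⟨G, hGS, h η hη⟩⟩

section Module

variable (P : Measure Ω) {E : Type*} [AddCommGroup E] [Module (L0 P) E]

/-- `B` is `L⁰`-absorbent: it `L⁰`-absorbs every element of the module. -/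
def L0Absorbent (B : Set E) : Prop :=
  ∀ x : E, ∃ ξ ∈ L0pp P, ∀ η : L0 P, |η| ≤ ξ → η • x ∈ B

/-- `B` is `L⁰`-convex. -/
def L0Convex (B : Set E) : Prop :=
  ∀ x ∈ B, ∀ y ∈ B, ∀ ξ : L0 P, 0 ≤ ξ → ξ ≤ 1 → ξ • x + (1 - ξ) • y ∈ B

/-- `B` is `L⁰`-balanced. -/
def L0Balanced (B : Set E) : Prop :=
  ∀ x ∈ B, ∀ η : L0 P, |η| ≤ 1 → η • x ∈ B

/-- A countable measurable partition of `Ω` (some pieces may be empty). -/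
structure IsPartition (A : ℕ → Set Ω) : Prop where
  measurableSet : ∀ n, MeasurableSet (A n)
  disjoint : Pairwise fun m n => Disjoint (A m) (A n)
  iUnion_eq : ⋃ n, A n = univ

variable (E) in
/-- Elements of `E` that agree on every piece of a countable partition are equal, so that
countable concatenations are unique. -/
def ConcatenationUnique : Prop :=
  ∀ (A : ℕ → Set Ω) (hA : IsPartition A) (x y : E),
    (∀ n, ind P (hA.measurableSet n) • x = ind P (hA.measurableSet n) • y) → x = y

/-- `G` has the countable concatenation property: for each sequence `x` in `G` and each countable
partition `A` there is a concatenation `∑ n, I_{A n} x n`, and it lies in `G`. -/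
def CountableConcatenation (G : Set E) : Prop :=
  ∀ (A : ℕ → Set Ω) (hA : IsPartition A) (x : ℕ → E), (∀ n, x n ∈ G) →
    ∃ z ∈ G, ∀ n, ind P (hA.measurableSet n) • z = ind P (hA.measurableSet n) • x n

section Topological

variable [TopologicalSpace E]

variable (E) in
/-- `E` is a locally `L⁰`-convex module: a topological module over `L0 P` with its topology `𝒯_c`
which has a local base at `0` of `L⁰`-balanced, `L⁰`-absorbent and `L⁰`-convex sets. -/
structure IsLocallyL0Convex : Prop where
  continuousAdd : ContinuousAdd E
  continuousSMul : ContinuousSMul (L0 P) E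
  exists_base : ∃ 𝓑 : Set (Set E), (𝓝 (0 : E)).HasBasis (fun U => U ∈ 𝓑) id ∧
    ∀ U ∈ 𝓑, L0Balanced P U ∧ L0Absorbent P U ∧ L0Convex P U

/-- An `L⁰`-barrel. -/
structure IsL0Barrel (U : Set E) : Prop where
  balanced : L0Balanced P U
  absorbent : L0Absorbent P U
  convex : L0Convex P U
  isClosed : IsClosed U

variable (E) in
/-- `E` is an `L⁰`-pre-barreled module: a locally `L⁰`-convex module in which every `L⁰`-barrel
with the countable concatenation property is a neighborhood of `0`. -/
structure IsL0PreBarreled : Prop where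
  locallyL0Convex : IsLocallyL0Convex P E
  mem_nhds : ∀ U : Set E, IsL0Barrel P U → CountableConcatenation P U → U ∈ 𝓝 (0 : E)

end Topological

end Module

/-- Addition of extended reals with the convention `+∞ + (-∞) = (-∞) + (+∞) = +∞`. -/
def upperAdd (a b : EReal) : EReal := if a = ⊤ ∨ b = ⊤ then ⊤ else a + b

section Function

variable {P : Measure Ω} {E : Type*}

/-- The effective domain of `f`: the points at which `f` is almost surely finite. -/
def dom (f : E → L0bar P) : Set E := {x | ∀ᵐ ω ∂P, f x ω ≠ ⊥ ∧ f x ω ≠ ⊤}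

/-- `f` is proper. -/
def IsProper (f : E → L0bar P) : Prop :=
  (dom f).Nonempty ∧ ∀ x, ∀ᵐ ω ∂P, ⊥ < f x ω

/-- `f` is lower semicontinuous: all its sublevel sets at levels in `L0 P` are closed. -/
def IsLowerSemicontinuous [TopologicalSpace E] (f : E → L0bar P) : Prop :=
  ∀ r : L0 P, IsClosed {x | ∀ᵐ ω ∂P, f x ω ≤ ((r ω : ℝ) : EReal)}

variable [AddCommGroup E] [Module (L0 P) E]

/-- `f` is an `L⁰`-convex function (in `EReal`, `0 * ⊤ = 0 * ⊥ = 0`). -/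
def IsL0ConvexFun (f : E → L0bar P) : Prop :=
  ∀ (x y : E) (ξ : L0 P), 0 ≤ ξ → ξ ≤ 1 →
    ∀ᵐ ω ∂P, f (ξ • x + (1 - ξ) • y) ω ≤
      upperAdd (((ξ ω : ℝ) : EReal) * f x ω) (((1 - ξ ω : ℝ) : EReal) * f y ω)

variable [TopologicalSpace E]

/-- The subdifferential of `f` at a point `x` of its effective domain: the set of all continuous
module homomorphisms `u` from `E` to `L0 P` (with its topology `𝒯_c`) such that
`u (y - x) ≤ f y - f x` for all `y`. -/
def subdifferential (f : E → L0bar P) (x : E) : Set (E →L[L0 P] L0 P) :=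
  {u | ∀ y : E, ∀ᵐ ω ∂P, ((u (y - x) ω : ℝ) : EReal) ≤ f y ω - f x ω}

end Function

end RandomConvex

end

namespace RandomConvex

variable {Ω : Type*} [MeasurableSpace Ω] {P : Measure Ω}

/-! ### The ordered algebra `L0 P` -/

/-! Let `a` be the finite value of `f` at `x`. The directional derivative `p y`, the essential
infimum over `t ∈ L0pp P` of `(f (x + t • y) - a) / t`, is `L0`-sublinear, so Hahn–Banach gives a
module homomorphism `u ≤ p`. Such a `u` is a subgradient as soon as it is continuous.

Continuity comes from the set `U` of all `y` with `f (x + y) ≤ a + 1` and `f (x - y) ≤ a + 1`.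
Convexity and lower semicontinuity make `U` convex, balanced and closed. Since `f` is local, `U`
inherits countable concatenations from `E`. Since `x` is interior to `dom f`, `f` is finite at two
opposite points of each line through `x`, and convexity then makes `U` absorbent. Pre-barreledness
turns `U` into a neighborhood of `0`, and there `u y ≤ 1` and `u (-y) ≤ 1`.

The argument runs on epigraphs (`EpiLE`), so infinite values of `f` hardly appear. The main lemmas
are `exists_linearMap_le`, `exists_linearMap_le_of_absorbent`, `symmSublevel_absorbent` and
`mem_subdifferential_of_forall_epiLE`. -/

instance isOrderedAddMonoidL0 (P : Measure Ω) : IsOrderedAddMonoid (L0 P) where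
  add_le_add_left a b h c := by
    rw [← AEEqFun.coeFn_le] at h ⊢
    filter_upwards [h, AEEqFun.coeFn_add a c, AEEqFun.coeFn_add b c] with ω h h1 h2
    simpa [h1, h2] using h

theorem mul_nonneg_L0 {a b : L0 P} (ha : 0 ≤ a) (hb : 0 ≤ b) : 0 ≤ a * b := by
  rw [← AEEqFun.coeFn_le] at ha hb ⊢
  filter_upwards [ha, hb, AEEqFun.coeFn_mul a b, AEEqFun.coeFn_zero (μ := P) (β := ℝ)]
    with ω h1 h2 h3 h4
  rw [h4] at h1 h2 ⊢
  rw [h3]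
  exact mul_nonneg h1 h2

instance zeroLEOneClassL0 (P : Measure Ω) : ZeroLEOneClass (L0 P) where
  zero_le_one := by
    rw [← AEEqFun.coeFn_le]
    filter_upwards [AEEqFun.coeFn_zero (μ := P) (β := ℝ), AEEqFun.coeFn_one (μ := P) (β := ℝ)]
      with ω h1 h2
    simp [h1, h2]

instance isOrderedRingL0 (P : Measure Ω) : IsOrderedRing (L0 P) :=
  .of_mul_nonneg fun _ _ => mul_nonneg_L0

theorem nonneg_of_mem_L0pp {t : L0 P} (ht : t ∈ L0pp P) : 0 ≤ t := by
  rw [← AEEqFun.coeFn_le]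
  have ht : ∀ᵐ ω ∂P, 0 < t ω := ht
  filter_upwards [ht, AEEqFun.coeFn_zero (μ := P) (β := ℝ)] with ω h1 h2
  rw [h2]
  exact h1.le

theorem mul_mem_L0pp {s t : L0 P} (hs : s ∈ L0pp P) (ht : t ∈ L0pp P) : s * t ∈ L0pp P := by
  have hs : ∀ᵐ ω ∂P, 0 < s ω := hs
  have ht : ∀ᵐ ω ∂P, 0 < t ω := ht
  show ∀ᵐ ω ∂P, 0 < (s * t) ω
  filter_upwards [hs, ht, AEEqFun.coeFn_mul s t] with ω h1 h2 h3
  rw [h3]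
  exact mul_pos h1 h2

theorem add_mem_L0pp {s t : L0 P} (hs : 0 ≤ s) (ht : t ∈ L0pp P) : s + t ∈ L0pp P := by
  rw [← AEEqFun.coeFn_le] at hs
  have ht : ∀ᵐ ω ∂P, 0 < t ω := ht
  show ∀ᵐ ω ∂P, 0 < (s + t) ω
  filter_upwards [hs, ht, AEEqFun.coeFn_add s t, AEEqFun.coeFn_zero (μ := P) (β := ℝ)]
    with ω h1 h2 h3 h4
  rw [h4] at h1
  rw [h3]
  exact add_pos_of_nonneg_of_pos h1 h2

theorem exists_inv_mem_L0pp {t : L0 P} (ht : t ∈ L0pp P) : ∃ s ∈ L0pp P, t * s = 1 := by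
  have ht : ∀ᵐ ω ∂P, 0 < t ω := ht
  refine ⟨AEEqFun.compMeasurable _ measurable_inv t, ?_, ?_⟩
  · show ∀ᵐ ω ∂P, 0 < (AEEqFun.compMeasurable _ measurable_inv t : L0 P) ω
    filter_upwards [ht, AEEqFun.coeFn_compMeasurable _ measurable_inv t] with ω h1 h2
    rw [h2]
    exact inv_pos.2 h1
  · ext
    filter_upwards [ht, AEEqFun.coeFn_compMeasurable _ measurable_inv t,
      AEEqFun.coeFn_mul t (AEEqFun.compMeasurable _ measurable_inv t),
      AEEqFun.coeFn_one (μ := P) (β := ℝ)] with ω h1 h2 h3 h4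
    rw [h3, h4, Pi.mul_apply, h2]
    exact mul_inv_cancel₀ h1.ne'

theorem le_of_mul_le_mul_L0pp {t a b : L0 P} (ht : t ∈ L0pp P) (h : t * a ≤ t * b) : a ≤ b := by
  obtain ⟨s, hs, hts⟩ := exists_inv_mem_L0pp ht
  have := mul_le_mul_of_nonneg_left h (nonneg_of_mem_L0pp hs)
  rwa [← mul_assoc, ← mul_assoc, mul_comm s, hts, one_mul, one_mul] at this

theorem abs_le_L0 {a b : L0 P} : |a| ≤ b ↔ -b ≤ a ∧ a ≤ b := by
  rw [abs_le', neg_le, and_comm]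

theorem coeFn_ind {A : Set Ω} (hA : MeasurableSet A) :
    ⇑(ind P hA) =ᵐ[P] A.indicator fun _ => (1 : ℝ) :=
  AEEqFun.coeFn_mk _ _

theorem ind_nonneg {A : Set Ω} (hA : MeasurableSet A) : 0 ≤ ind P hA := by
  rw [← AEEqFun.coeFn_le]
  filter_upwards [coeFn_ind (P := P) hA, AEEqFun.coeFn_zero (μ := P) (β := ℝ)] with ω h1 h2
  rw [h1, h2]
  exact indicator_nonneg (fun _ _ => zero_le_one) ω

theorem ind_le_one {A : Set Ω} (hA : MeasurableSet A) : ind P hA ≤ 1 := by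
  rw [← AEEqFun.coeFn_le]
  filter_upwards [coeFn_ind (P := P) hA, AEEqFun.coeFn_one (μ := P) (β := ℝ)] with ω h1 h2
  rw [h1, h2]
  exact indicator_le' (fun _ _ => le_rfl) (fun _ _ => zero_le_one) ω

theorem ind_mul_self {A : Set Ω} (hA : MeasurableSet A) : ind P hA * ind P hA = ind P hA := by
  ext
  filter_upwards [coeFn_ind (P := P) hA, AEEqFun.coeFn_mul (ind P hA) (ind P hA)] with ω h1 h2
  rw [h2, Pi.mul_apply, h1]
  by_cases h : ω ∈ A <;> simp [h]

/-! ### Essential infima -/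

section EssInf

variable [IsProbabilityMeasure P]

theorem integrable_arctan_coe (c : L0 P) : Integrable (fun ω => Real.arctan (c ω)) P := by
  refine Integrable.of_bound (C := Real.pi / 2)
    (Real.continuous_arctan.comp_aestronglyMeasurable c.aestronglyMeasurable) (.of_forall fun ω => ?_)
  rw [Real.norm_eq_abs, abs_le]
  exact ⟨(Real.neg_pi_div_two_lt_arctan _).le, (Real.arctan_lt_pi_div_two _).le⟩

theorem tendsto_integral_arctan {v : ℕ → L0 P} {h : L0 P}
    (hv : ∀ᵐ ω ∂P, Filter.Tendsto (fun n => v n ω) Filter.atTop (𝓝 (h ω))) :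
    Filter.Tendsto (fun n => ∫ ω, Real.arctan (v n ω) ∂P) Filter.atTop
      (𝓝 (∫ ω, Real.arctan (h ω) ∂P)) := by
  refine tendsto_integral_of_dominated_convergence (fun _ => Real.pi / 2)
    (fun n => (integrable_arctan_coe (v n)).1) (integrable_const _)
    (fun n => .of_forall fun ω => ?_) ?_
  · rw [Real.norm_eq_abs, abs_le]
    exact ⟨(Real.neg_pi_div_two_lt_arctan _).le, (Real.arctan_lt_pi_div_two _).le⟩
  · filter_upwards [hv] with ω h
    exact (Real.continuous_arctan.tendsto _).comp h

/-- The functional `c ↦ ∫ arctan c` is finite and strictly increasing on `L0 P`, so the limit of a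
decreasing minimizing sequence in `T` is the infimum. -/
theorem exists_isGLB_of_infClosed {T : Set (L0 P)} (hT : InfClosed T) (hne : T.Nonempty)
    (hbd : BddBelow T) : ∃ h, IsGLB T h := by
  obtain ⟨b, hb⟩ := hbd
  set φ : L0 P → ℝ := fun c => ∫ ω, Real.arctan (c ω) ∂P with hφ
  have hmono : ∀ {c d : L0 P}, c ≤ d → φ c ≤ φ d := fun {c d} h =>
    integral_mono_ae (integrable_arctan_coe c) (integrable_arctan_coe d) <| by
      filter_upwards [AEEqFun.coeFn_le.2 h] with ω h using Real.arctan_mono h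
  have hbdd : BddBelow (φ '' T) := ⟨φ b, by rintro _ ⟨c, hc, rfl⟩; exact hmono (hb hc)⟩
  obtain ⟨r, -, hr, hrT⟩ := exists_seq_tendsto_sInf (hne.image φ) hbdd
  choose u huT hur using hrT
  -- Running infima stay in `T` and still minimize `φ`.
  let v : ℕ → L0 P := fun n => n.rec (u 0) fun n c => c ⊓ u (n + 1)
  have hvT : ∀ n, v n ∈ T := fun n => by
    induction n with
    | zero => exact huT 0
    | succ n ih => exact hT ih (huT _)
  have hvu : ∀ n, v n ≤ u n := fun n => by
    cases n with
    | zero => exact le_rfl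
    | succ n => exact inf_le_right
  have hv : Antitone v := antitone_nat_of_succ_le fun n => inf_le_left
  have hva : ∀ᵐ ω ∂P, Antitone fun n => v n ω := by
    have : ∀ᵐ ω ∂P, ∀ n, v (n + 1) ω ≤ v n ω :=
      ae_all_iff.2 fun n => AEEqFun.coeFn_le.2 (hv n.le_succ)
    filter_upwards [this] with ω h using antitone_nat_of_succ_le h
  have hbv : ∀ᵐ ω ∂P, ∀ n, b ω ≤ v n ω := ae_all_iff.2 fun n => AEEqFun.coeFn_le.2 (hb (hvT n))
  have hmeas : AEMeasurable (fun ω => ⨅ n, v n ω) P :=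
    AEMeasurable.iInf fun n => (v n).measurable.aemeasurable
  let h : L0 P := AEEqFun.mk _ hmeas.aestronglyMeasurable
  have hh : ∀ᵐ ω ∂P, h ω = ⨅ n, v n ω := AEEqFun.coeFn_mk _ _
  have hlim : ∀ᵐ ω ∂P, Filter.Tendsto (fun n => v n ω) Filter.atTop (𝓝 (h ω)) := by
    filter_upwards [hva, hbv, hh] with ω h1 h2 h3
    rw [h3]
    exact tendsto_atTop_ciInf h1 ⟨b ω, by rintro _ ⟨n, rfl⟩; exact h2 n⟩
  have hge : ∀ c ∈ T, sInf (φ '' T) ≤ φ c := fun c hc => csInf_le hbdd (mem_image_of_mem φ hc)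
  have hφh : φ h = sInf (φ '' T) := by
    refine tendsto_nhds_unique (tendsto_integral_arctan hlim) ?_
    refine tendsto_of_tendsto_of_tendsto_of_le_of_le tendsto_const_nhds hr
      (fun n => hge _ (hvT n)) fun n => ?_
    rw [← hur n]
    exact hmono (hvu n)
  refine ⟨h, fun s hs => ?_, fun d hd => ?_⟩
  · have hlim' : ∀ᵐ ω ∂P, Filter.Tendsto (fun n => (v n ⊓ s) ω) Filter.atTop (𝓝 ((h ⊓ s) ω)) := by
      have h0 : ∀ᵐ ω ∂P, ∀ n, (v n ⊓ s) ω = v n ω ⊓ s ω :=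
        ae_all_iff.2 fun n => AEEqFun.coeFn_inf _ _
      filter_upwards [hlim, h0, AEEqFun.coeFn_inf h s] with ω h1 h2 h3
      simp only [h2, h3]
      exact h1.inf_nhds tendsto_const_nhds
    -- `h ⊓ s` is a limit of the elements `v n ⊓ s` of `T`, so `φ` cannot drop below its infimum
    -- there; strict monotonicity forces `h ⊓ s = h`.
    have h1 : sInf (φ '' T) ≤ φ (h ⊓ s) :=
      ge_of_tendsto' (tendsto_integral_arctan hlim') fun n => hge _ (hT (hvT n) hs)
    have h2 : φ (h ⊓ s) = φ h := le_antisymm (hmono inf_le_left) (hφh ▸ h1)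
    have h3 := (integral_eq_iff_of_ae_le (integrable_arctan_coe (h ⊓ s)) (integrable_arctan_coe h)
      (by filter_upwards [AEEqFun.coeFn_le.2 (inf_le_left : h ⊓ s ≤ h)] with ω h
            using Real.arctan_mono h)).1 h2
    rw [← inf_eq_left]
    ext
    filter_upwards [h3] with ω h using Real.arctan_injective h
  · rw [← AEEqFun.coeFn_le]
    have : ∀ᵐ ω ∂P, ∀ n, d ω ≤ v n ω := ae_all_iff.2 fun n => AEEqFun.coeFn_le.2 (hd (hvT n))
    filter_upwards [this, hh] with ω h1 h2
    rw [h2]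
    exact le_ciInf h1

theorem exists_isGLB_L0 {S : Set (L0 P)} (hne : S.Nonempty) (hbd : BddBelow S) :
    ∃ h, IsGLB S h := by
  obtain ⟨h, hh⟩ := exists_isGLB_of_infClosed (T := infClosure S) infClosed_infClosure
    (hne.mono subset_infClosure) (by
      obtain ⟨b, hb⟩ := hbd
      exact ⟨b, by rwa [lowerBounds_infClosure]⟩)
  exact ⟨h, by rwa [isGLB_infClosure] at hh⟩

end EssInf

/-! ### The Hahn–Banach theorem for `L0`-sublinear functions -/

section HahnBanach

variable {E : Type*} [AddCommGroup E] [Module (L0 P) E]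

/-- `p` is subadditive and positively homogeneous with respect to `L0pp P`. -/
structure IsL0Sublinear (p : E → L0 P) : Prop where
  add_le : ∀ x y, p (x + y) ≤ p x + p y
  smul_eq : ∀ t ∈ L0pp P, ∀ x, p (t • x) = t * p x

theorem IsL0Sublinear.map_zero {p : E → L0 P} (hp : IsL0Sublinear p) : p 0 = 0 := by
  have h := hp.smul_eq (1 + 1) (add_mem_L0pp (nonneg_of_mem_L0pp (one_mem_L0pp P))
    (one_mem_L0pp P)) 0
  rw [smul_zero, add_mul, one_mul] at h
  exact left_eq_add.1 h

variable [IsProbabilityMeasure P]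

/-- Fibrewise infima of an `L0`-convex cone in `E × L0 P` form an `L0`-sublinear function. -/
theorem exists_isL0Sublinear_isGLB {S : E → Set (L0 P)} (hne : ∀ x, (S x).Nonempty)
    (hadd : ∀ x y, ∀ c ∈ S x, ∀ d ∈ S y, ∃ e ∈ S (x + y), e ≤ c + d)
    (hsmul : ∀ t ∈ L0pp P, ∀ x, ∀ c ∈ S x, t * c ∈ S (t • x)) (h0 : ∀ c ∈ S 0, 0 ≤ c) :
    ∃ p : E → L0 P, IsL0Sublinear p ∧ ∀ x, IsGLB (S x) (p x) := by
  have hbd : ∀ x, BddBelow (S x) := fun x => by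
    obtain ⟨d, hd⟩ := hne (-x)
    refine ⟨-d, fun c hc => ?_⟩
    obtain ⟨e, he, hle⟩ := hadd x (-x) c hc d hd
    rw [add_neg_cancel] at he
    exact neg_le_iff_add_nonneg.2 ((h0 e he).trans hle)
  choose p hp using fun x => exists_isGLB_L0 (hne x) (hbd x)
  -- One inequality suffices: used for the inverse of `t`, it yields the other.
  have hle : ∀ t ∈ L0pp P, ∀ x, p (t • x) ≤ t * p x := fun t ht x => by
    obtain ⟨s, hs, hts⟩ := exists_inv_mem_L0pp ht
    have : s * p (t • x) ≤ p x := (hp x).2 fun c hc => by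
      have := mul_le_mul_of_nonneg_left ((hp (t • x)).1 (hsmul t ht x c hc))
        (nonneg_of_mem_L0pp hs)
      rwa [← mul_assoc, mul_comm s t, hts, one_mul] at this
    have := mul_le_mul_of_nonneg_left this (nonneg_of_mem_L0pp ht)
    rwa [← mul_assoc, hts, one_mul] at this
  refine ⟨p, ⟨fun x y => ?_, fun t ht x => (hle t ht x).antisymm ?_⟩, hp⟩
  · rw [← sub_le_iff_le_add]
    refine (hp x).2 fun c hc => ?_
    rw [sub_le_iff_le_add', ← sub_le_iff_le_add]
    refine (hp y).2 fun d hd => ?_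
    obtain ⟨e, he, hle⟩ := hadd x y c hc d hd
    rw [sub_le_iff_le_add, add_comm d]
    exact ((hp (x + y)).1 he).trans hle
  · obtain ⟨s, hs, hts⟩ := exists_inv_mem_L0pp ht
    have := mul_le_mul_of_nonneg_left (hle s hs (t • x)) (nonneg_of_mem_L0pp ht)
    rwa [smul_smul, mul_comm s t, ← mul_assoc, hts, one_mul, one_smul] at this

theorem IsL0Sublinear.exists_minimal {p : E → L0 P} (hp : IsL0Sublinear p) :
    ∃ q, q ≤ p ∧ Minimal IsL0Sublinear q := by
  -- Zorn's lemma in the dual order: an upper bound of a chain is its pointwise infimum.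
  have hbdd : ∀ C ⊆ {q : (E → L0 P)ᵒᵈ | IsL0Sublinear (P := P) (E := E) q},
      IsChain (· ≤ ·) C → ∀ p₀ ∈ C, ∃ r ∈ {q | IsL0Sublinear (P := P) (E := E) q},
        ∀ q ∈ C, q ≤ r := by
    intro C hC hchain p₀ hp₀
    obtain ⟨r, hr, hrg⟩ := exists_isL0Sublinear_isGLB (P := P)
      (S := fun x => {c | ∃ q : E → L0 P, q ∈ C ∧ q x = c}) (fun x => ⟨_, p₀, hp₀, rfl⟩)
      (by
        rintro x y _ ⟨q₁, h₁, rfl⟩ _ ⟨q₂, h₂, rfl⟩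
        rcases hchain.total h₁ h₂ with h | h
        · exact ⟨_, ⟨q₂, h₂, rfl⟩, ((hC h₂).add_le x y).trans (add_le_add_left (h x) _)⟩
        · exact ⟨_, ⟨q₁, h₁, rfl⟩, ((hC h₁).add_le x y).trans (add_le_add_right (h y) _)⟩)
      (by
        rintro t ht x _ ⟨q₁, h₁, rfl⟩
        exact ⟨q₁, h₁, (hC h₁).smul_eq t ht x⟩)
      (by
        rintro _ ⟨q₁, h₁, rfl⟩
        exact (hC h₁).map_zero.ge)
    exact ⟨r, hr, fun q hq x => (hrg x).1 ⟨q, hq, rfl⟩⟩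
  obtain ⟨q, hq, hqm⟩ := zorn_le_nonempty₀ _ hbdd p hp
  exact ⟨q, hq, hqm.1, fun r hr hrq => hqm.2 hr hrq⟩

/-- The infimum over `t` of `p (y + t • x) - t * p x` is again sublinear and at most `p`, hence
equals `p` by minimality; `t = 1` gives the claim. -/
theorem add_le_of_minimal {p : E → L0 P} (hp : Minimal IsL0Sublinear p) (x y : E) :
    p y + p x ≤ p (y + x) := by
  have hs := hp.1
  obtain ⟨r, hr, hrg⟩ := exists_isL0Sublinear_isGLB (P := P)
    (S := fun y => {c | ∃ t ∈ L0pp P, p (y + t • x) - t * p x = c})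
    (fun y => ⟨_, 1, one_mem_L0pp P, rfl⟩)
    (by
      rintro y z _ ⟨s, hs', rfl⟩ _ ⟨t, ht, rfl⟩
      refine ⟨_, ⟨s + t, add_mem_L0pp (nonneg_of_mem_L0pp hs') ht, rfl⟩, ?_⟩
      have := hs.add_le (y + s • x) (z + t • x)
      rw [add_add_add_comm, ← add_smul] at this
      calc _ ≤ p (y + s • x) + p (z + t • x) - (s + t) * p x := sub_le_sub_right this _
        _ = _ := by ring)
    (by
      rintro t ht y _ ⟨s, hs', rfl⟩
      refine ⟨t * s, mul_mem_L0pp ht hs', ?_⟩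
      rw [mul_smul, ← smul_add, hs.smul_eq t ht]
      ring)
    (by
      rintro _ ⟨t, ht, rfl⟩
      rw [zero_add, hs.smul_eq t ht, sub_self])
  have hrp : r ≤ p := fun y => by
    have h1 := (hrg y).1 ⟨1, one_mem_L0pp P, rfl⟩
    rw [one_smul, one_mul] at h1
    exact h1.trans (sub_le_iff_le_add.2 (hs.add_le y x))
  have h1 := (hp.2 hr hrp y).trans ((hrg y).1 ⟨1, one_mem_L0pp P, rfl⟩)
  rw [one_smul, one_mul] at h1
  exact le_sub_iff_add_le.1 h1

theorem exists_linearMap_le {p : E → L0 P} (hp : IsL0Sublinear p) :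
    ∃ u : E →ₗ[L0 P] L0 P, ∀ x, u x ≤ p x := by
  obtain ⟨q, hqp, hq⟩ := hp.exists_minimal
  have hadd : ∀ x y, q (x + y) = q x + q y := fun x y =>
    (hq.1.add_le x y).antisymm (add_le_of_minimal hq y x)
  refine ⟨⟨⟨q, hadd⟩, fun η x => ?_⟩, hqp⟩
  -- Homogeneity extends from `L0pp P` to all scalars by writing `η` as the difference of `|η| + 1`
  -- and `|η| - η + 1`.
  have hneg : 0 ≤ |η| - η := sub_nonneg.2 (le_abs_self η)
  have h1 : |η| + 1 ∈ L0pp P := add_mem_L0pp (abs_nonneg η) (one_mem_L0pp P)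
  have h2 : |η| - η + 1 ∈ L0pp P := add_mem_L0pp hneg (one_mem_L0pp P)
  have h3 := hadd (η • x) ((|η| - η + 1) • x)
  rw [← add_smul, show η + (|η| - η + 1) = |η| + 1 by ring, hq.1.smul_eq _ h1,
    hq.1.smul_eq _ h2] at h3
  show q (η • x) = η * q x
  linear_combination -h3

end HahnBanach

/-! ### Continuity of linear maps that are bounded near zero -/

section Continuity

variable {E : Type*} [AddCommGroup E] [Module (L0 P) E] [TopologicalSpace E]

theorem IsLocallyL0Convex.continuous_const_add (hE : IsLocallyL0Convex P E) (x : E) :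
    Continuous fun y : E => x + y :=
  haveI := hE.continuousAdd
  continuous_const.add continuous_id

theorem IsLocallyL0Convex.continuous_const_smul (hE : IsLocallyL0Convex P E) (η : L0 P) :
    Continuous fun y : E => η • y :=
  haveI := hE.continuousSMul
  continuous_const.smul continuous_id

theorem IsLocallyL0Convex.absorbent_of_mem_nhds (hE : IsLocallyL0Convex P E) {W : Set E}
    (hW : W ∈ 𝓝 (0 : E)) : L0Absorbent P W := by
  obtain ⟨𝓑, hB, h⟩ := hE.exists_base
  obtain ⟨U, hU, hUW⟩ := hB.mem_iff.1 hW
  intro x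
  obtain ⟨ξ, hξ, h'⟩ := (h U hU).2.1 x
  exact ⟨ξ, hξ, fun η hη => hUW (h' η hη)⟩

theorem IsLocallyL0Convex.continuous_of_abs_le_one (hE : IsLocallyL0Convex P E)
    (u : E →ₗ[L0 P] L0 P) {U : Set E} (hU : U ∈ 𝓝 (0 : E)) (hu : ∀ y ∈ U, |u y| ≤ 1) :
    Continuous u := by
  rw [continuous_iff_continuousAt]
  intro x V hV
  obtain ⟨G, hGV, hG, hxG⟩ := mem_nhds_iff.1 hV
  obtain ⟨ε, hε, hεG⟩ := hG _ hxG
  obtain ⟨δ, -, hδ⟩ := exists_inv_mem_L0pp hε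
  have hcont : Continuous fun y : E => δ • (-x + y) :=
    (hE.continuous_const_smul δ).comp (hE.continuous_const_add (-x))
  have hmem : (fun y : E => δ • (-x + y)) ⁻¹' U ∈ 𝓝 x :=
    hcont.continuousAt (by simpa using hU)
  refine Filter.mem_map.2 (Filter.mem_of_superset hmem fun y hy => hGV ?_)
  -- With `δ` the inverse of `ε`, the bound `1` on `U` rescales to the bound `ε` on `u y - u x`.
  have h1 : u y = u x + ε * u (δ • (-x + y)) := by
    rw [map_smul, smul_eq_mul, ← mul_assoc, hδ, one_mul, map_add, map_neg, add_neg_cancel_left]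
  show u y ∈ G
  rw [h1]
  refine hεG _ (abs_le_L0.2 ?_)
  have h2 := abs_le_L0.1 (hu _ hy)
  have hε0 := nonneg_of_mem_L0pp hε
  have h3 := mul_le_mul_of_nonneg_left h2.1 hε0
  have h4 := mul_le_mul_of_nonneg_left h2.2 hε0
  rw [mul_neg, mul_one] at h3
  rw [mul_one] at h4
  exact ⟨h3, h4⟩

end Continuity

/-! ### Epigraphs of `L0`-convex functions -/

/-- `(x, c)` belongs to the epigraph of `f`. -/
def EpiLE {E : Type*} (f : E → L0bar P) (x : E) (c : L0 P) : Prop :=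
  ∀ᵐ ω ∂P, f x ω ≤ ((c ω : ℝ) : EReal)

theorem EpiLE.mono {E : Type*} {f : E → L0bar P} {x : E} {c d : L0 P} (h : EpiLE f x c)
    (hcd : c ≤ d) : EpiLE f x d := by
  filter_upwards [h, AEEqFun.coeFn_le.2 hcd] with ω h1 h2
  exact h1.trans (EReal.coe_le_coe_iff.2 h2)

theorem exists_coe_of_mem_dom {E : Type*} {f : E → L0bar P} {x : E} (hx : x ∈ dom f) :
    ∃ a : L0 P, ∀ᵐ ω ∂P, f x ω = ((a ω : ℝ) : EReal) := by
  have hx : ∀ᵐ ω ∂P, f x ω ≠ ⊥ ∧ f x ω ≠ ⊤ := hx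
  refine ⟨AEEqFun.compMeasurable _ measurable_ereal_toReal (f x), ?_⟩
  filter_upwards [hx, AEEqFun.coeFn_compMeasurable _ measurable_ereal_toReal (f x)] with ω h1 h2
  rw [h2]
  exact (EReal.coe_toReal h1.2 h1.1).symm

section Epigraph

variable {E : Type*} [AddCommGroup E] [Module (L0 P) E] {f : E → L0bar P}

theorem IsL0ConvexFun.epiLE (hf : IsL0ConvexFun f) {x y : E} {c d ξ : L0 P} (hx : EpiLE f x c)
    (hy : EpiLE f y d) (h0 : 0 ≤ ξ) (h1 : ξ ≤ 1) :
    EpiLE f (ξ • x + (1 - ξ) • y) (ξ * c + (1 - ξ) * d) := by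
  filter_upwards [hf x y ξ h0 h1, hx, hy, AEEqFun.coeFn_le.2 h0, AEEqFun.coeFn_le.2 h1,
    AEEqFun.coeFn_zero (μ := P) (β := ℝ), AEEqFun.coeFn_one (μ := P) (β := ℝ),
    AEEqFun.coeFn_add (ξ * c) ((1 - ξ) * d), AEEqFun.coeFn_mul ξ c, AEEqFun.coeFn_mul (1 - ξ) d,
    AEEqFun.coeFn_sub 1 ξ] with ω hf hx hy h0 h1 e0 e1 e2 e3 e4 e5
  rw [e0] at h0
  rw [e1] at h1
  refine hf.trans ?_
  have hx' : ((ξ ω : ℝ) : EReal) * f x ω ≤ ((ξ ω * c ω : ℝ) : EReal) := by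
    rw [EReal.coe_mul]
    exact mul_le_mul_of_nonneg_left hx (EReal.coe_nonneg.2 h0)
  have hy' : ((1 - ξ ω : ℝ) : EReal) * f y ω ≤ (((1 - ξ ω) * d ω : ℝ) : EReal) := by
    rw [EReal.coe_mul]
    exact mul_le_mul_of_nonneg_left hy (EReal.coe_nonneg.2 (sub_nonneg.2 h1))
  rw [upperAdd, if_neg (not_or.2 ⟨(hx'.trans_lt (EReal.coe_lt_top _)).ne,
    (hy'.trans_lt (EReal.coe_lt_top _)).ne⟩)]
  rw [e2, Pi.add_apply, e3, e4, Pi.mul_apply, Pi.mul_apply, e5, Pi.sub_apply, e1, EReal.coe_add]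
  exact add_le_add hx' hy'

/-- Locality of `f`: `z` is the convex combination of `x` and `z` with weight the indicator of `A`,
and on `A` the term with `f z` is multiplied by `0`. -/
theorem IsL0ConvexFun.ae_le_of_ind_smul_eq (hf : IsL0ConvexFun f) {A : Set Ω}
    (hA : MeasurableSet A) {x z : E} (h : ind P hA • z = ind P hA • x) :
    ∀ᵐ ω ∂P, ω ∈ A → f z ω ≤ f x ω := by
  have hz : ind P hA • x + (1 - ind P hA) • z = z := by
    rw [sub_smul, one_smul, ← h, add_sub_cancel]
  filter_upwards [hf x z _ (ind_nonneg hA) (ind_le_one hA), coeFn_ind (P := P) hA]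
    with ω h1 h2 hω
  rw [hz, h2, indicator_of_mem hω] at h1
  refine h1.trans ?_
  rw [upperAdd]
  split_ifs with h3
  · simp at h3
    simp [h3]
  · simp

/-- Difference quotients of `f` at `x` are subadditive in the direction. -/
theorem IsL0ConvexFun.exists_epiLE_add_smul_add (hf : IsL0ConvexFun f) {x y z : E} {a c d s t : L0 P}
    (hs : s ∈ L0pp P) (ht : t ∈ L0pp P) (hy : EpiLE f (x + s • y) (a + s * c))
    (hz : EpiLE f (x + t • z) (a + t * d)) :
    ∃ r ∈ L0pp P, EpiLE f (x + r • (y + z)) (a + r * (c + d)) := by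
  -- The weights `t / (s + t)` and `s / (s + t)` give `y` and `z` the common step `r = s * t / (s +
  -- t)`.
  obtain ⟨w, hw, hstw⟩ := exists_inv_mem_L0pp (add_mem_L0pp (nonneg_of_mem_L0pp hs) ht)
  have hξ0 : 0 ≤ w * t := nonneg_of_mem_L0pp (mul_mem_L0pp hw ht)
  have hsub : 1 - w * t = w * s := by linear_combination -hstw
  have hξ1 : w * t ≤ 1 := by
    rw [← sub_nonneg, hsub]
    exact nonneg_of_mem_L0pp (mul_mem_L0pp hw hs)
  refine ⟨w * (s * t), mul_mem_L0pp hw (mul_mem_L0pp hs ht), ?_⟩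
  have h := hf.epiLE hy hz hξ0 hξ1
  have e1 : (w * t) • (x + s • y) + (1 - w * t) • (x + t • z) = x + (w * (s * t)) • (y + z) := by
    rw [smul_add, smul_add, smul_smul, smul_smul, add_add_add_comm, ← add_smul,
      add_sub_cancel, one_smul, hsub, smul_add]
    congr 3 <;> ring_nf
  have e2 : w * t * (a + s * c) + (1 - w * t) * (a + t * d) = a + w * (s * t) * (c + d) := by
    linear_combination (t * d) * hsub
  rwa [e1, e2] at h

theorem epiLE_add_of_epiLE (hf : IsL0ConvexFun f) {x y : E} {a c ξ : L0 P} (hx : EpiLE f x a)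
    (hy : EpiLE f (x + y) (a + c)) (h0 : 0 ≤ ξ) (h1 : ξ ≤ 1) :
    EpiLE f (x + ξ • y) (a + ξ * c) := by
  have h := hf.epiLE hy hx h0 h1
  have e1 : ξ • (x + y) + (1 - ξ) • x = x + ξ • y := by module
  have e2 : ξ * (a + c) + (1 - ξ) * a = a + ξ * c := by ring
  rwa [e1, e2] at h

theorem IsL0ConvexFun.epiLE_of_partition (hf : IsL0ConvexFun f) {A : ℕ → Set Ω}
    (hA : IsPartition A) {x : ℕ → E} {z : E} {r : L0 P} (hx : ∀ n, EpiLE f (x n) r)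
    (hz : ∀ n, ind P (hA.measurableSet n) • z = ind P (hA.measurableSet n) • x n) :
    EpiLE f z r := by
  have h1 : ∀ᵐ ω ∂P, ∀ n, ω ∈ A n → f z ω ≤ f (x n) ω :=
    ae_all_iff.2 fun n => hf.ae_le_of_ind_smul_eq _ (hz n)
  filter_upwards [h1, ae_all_iff.2 hx] with ω h1 h2
  obtain ⟨n, hn⟩ := mem_iUnion.1 (hA.iUnion_eq.symm ▸ mem_univ ω : ω ∈ ⋃ n, A n)
  exact (h1 n hn).trans (h2 n)

/-- The symmetric sublevel set of `f` around `x` at level `r`. -/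
def symmSublevel (f : E → L0bar P) (x : E) (r : L0 P) : Set E :=
  {y | EpiLE f (x + y) r ∧ EpiLE f (x + -y) r}

theorem exists_two_mul_L0 (P : Measure Ω) : ∃ h ∈ L0pp P, (1 + 1) * h = 1 :=
  exists_inv_mem_L0pp (add_mem_L0pp (nonneg_of_mem_L0pp (one_mem_L0pp P)) (one_mem_L0pp P))

theorem symmSublevel_convex (hf : IsL0ConvexFun f) (x : E) (r : L0 P) :
    L0Convex P (symmSublevel f x r) := by
  rintro y ⟨hy, hy'⟩ z ⟨hz, hz'⟩ ξ h0 h1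
  have h := hf.epiLE hy hz h0 h1
  have h' := hf.epiLE hy' hz' h0 h1
  have e : ξ * r + (1 - ξ) * r = r := by ring
  rw [e] at h h'
  refine ⟨?_, ?_⟩
  · rwa [show ξ • (x + y) + (1 - ξ) • (x + z) = x + (ξ • y + (1 - ξ) • z) by module] at h
  · rwa [show ξ • (x + -y) + (1 - ξ) • (x + -z) = x + -(ξ • y + (1 - ξ) • z) by module] at h'

theorem symmSublevel_balanced (hf : IsL0ConvexFun f) (x : E) (r : L0 P) :
    L0Balanced P (symmSublevel f x r) := by
  intro y hy η hη
  obtain ⟨k, hk, hk2⟩ := exists_two_mul_L0 P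
  have hk0 := nonneg_of_mem_L0pp hk
  obtain ⟨h1, h2⟩ := abs_le_L0.1 hη
  have hy' : -y ∈ symmSublevel f x r := ⟨hy.2, by rw [neg_neg]; exact hy.1⟩
  -- `η • y` is the convex combination of `y` and `-y` with weight `(1 + η) / 2`.
  have h := symmSublevel_convex hf x r y hy (-y) hy' (k * (1 + η))
    (mul_nonneg hk0 (by rwa [← neg_le_iff_add_nonneg'])) (by
      have := mul_le_mul_of_nonneg_left (add_le_add_right h2 1) hk0
      rwa [mul_comm k (1 + 1), hk2] at this)
  have e : (k * (1 + η)) • y + (1 - k * (1 + η)) • -y = η • y := by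
    rw [smul_neg, ← sub_eq_add_neg, ← sub_smul]
    congr 1
    linear_combination (1 + η) * hk2
  rwa [e] at h

theorem symmSublevel_countableConcatenation (hf : IsL0ConvexFun f)
    (hE : CountableConcatenation P (univ : Set E)) (x : E) (r : L0 P) :
    CountableConcatenation P (symmSublevel f x r) := by
  intro A hA y hy
  obtain ⟨z, -, hz⟩ := hE A hA y fun _ => mem_univ _
  refine ⟨z, ⟨hf.epiLE_of_partition hA (fun n => (hy n).1) fun n => ?_,
    hf.epiLE_of_partition hA (fun n => (hy n).2) fun n => ?_⟩, hz⟩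
  · rw [smul_add, smul_add, hz]
  · rw [smul_add, smul_add, smul_neg, smul_neg, hz]

/-- A linear minorant of the directional derivative of `f` at `x`. -/
theorem exists_linearMap_le_of_absorbent [IsProbabilityMeasure P] (hf : IsL0ConvexFun f) {x : E} {a : L0 P}
    (ha : ∀ᵐ ω ∂P, f x ω = ((a ω : ℝ) : EReal))
    (habs : L0Absorbent P (symmSublevel f x (a + 1))) :
    ∃ u : E →ₗ[L0 P] L0 P, ∀ y c, EpiLE f (x + y) (a + c) → u y ≤ c := by
  obtain ⟨p, hp, hpg⟩ := exists_isL0Sublinear_isGLB (P := P)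
    (S := fun y => {c | ∃ t ∈ L0pp P, EpiLE f (x + t • y) (a + t * c)})
    (fun y => by
      obtain ⟨t, ht, h⟩ := habs y
      obtain ⟨s, hs, hts⟩ := exists_inv_mem_L0pp ht
      -- With `s` the inverse of `t`, the level `a + t * s` is exactly `a + 1`.
      refine ⟨s, t, ht, ?_⟩
      rw [hts]
      exact (h t (abs_of_nonneg (nonneg_of_mem_L0pp ht)).le).1)
    (by
      rintro y z c ⟨s, hs, hc⟩ d ⟨t, ht, hd⟩
      exact ⟨_, hf.exists_epiLE_add_smul_add hs ht hc hd, le_rfl⟩)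
    (by
      rintro t ht y c ⟨s, hs, hc⟩
      obtain ⟨v, hv, htv⟩ := exists_inv_mem_L0pp ht
      refine ⟨s * v, mul_mem_L0pp hs hv, ?_⟩
      rwa [smul_smul, mul_assoc, mul_comm v, htv, mul_one,
        show s * v * (t * c) = s * c by linear_combination (s * c) * htv])
    (by
      rintro c ⟨t, ht, hc⟩
      rw [smul_zero, add_zero] at hc
      have h : a ≤ a + t * c := by
        rw [← AEEqFun.coeFn_le]
        filter_upwards [ha, hc] with ω h1 h2
        rw [h1] at h2
        exact EReal.coe_le_coe_iff.1 h2
      refine le_of_mul_le_mul_L0pp ht ?_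
      rw [mul_zero]
      exact (le_add_iff_nonneg_right a).1 h)
  obtain ⟨u, hu⟩ := exists_linearMap_le hp
  refine ⟨u, fun y c h => (hu y).trans ((hpg y).1 ⟨1, one_mem_L0pp P, ?_⟩)⟩
  rwa [one_smul, one_mul]

end Epigraph

/-! ### Subgradients -/

section Subgradient

variable {E : Type*} [AddCommGroup E] [Module (L0 P) E] [TopologicalSpace E] {f : E → L0bar P}

theorem symmSublevel_absorbent (hf : IsL0ConvexFun f) (hE : IsLocallyL0Convex P E) {x : E}
    (hx : x ∈ interior (dom f)) {a : L0 P} (ha : EpiLE f x a) :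
    L0Absorbent P (symmSublevel f x (a + 1)) := by
  have hW : (fun y => x + y) ⁻¹' dom f ∈ 𝓝 (0 : E) :=
    (hE.continuous_const_add x).continuousAt
      (by simpa using mem_interior_iff_mem_nhds.1 hx)
  have key : ∀ y, x + y ∈ dom f → ∃ m : L0 P, 0 ≤ m ∧ EpiLE f (x + y) (a + m) := fun y hy => by
    obtain ⟨c, hc⟩ := exists_coe_of_mem_dom hy
    have hc' : EpiLE f (x + y) c := hc.mono fun ω h => h.le
    refine ⟨|c - a|, abs_nonneg _, hc'.mono ?_⟩
    rw [← sub_le_iff_le_add']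
    exact le_abs_self _
  intro y
  obtain ⟨ε, hε, hεW⟩ := hE.absorbent_of_mem_nhds hW y
  have hε0 := nonneg_of_mem_L0pp hε
  obtain ⟨m, hm, h1⟩ := key _ (hεW ε (abs_of_nonneg hε0).le)
  obtain ⟨m', hm', h2⟩ := key _ (hεW (-ε) (by rw [abs_neg, abs_of_nonneg hε0]))
  -- `m` and `m'` bound the growth of `f` at `x ± ε • y`; shrinking the step by `l = 1 / (m + m' +
  -- 1)` brings both below `1`.
  obtain ⟨l, hl, hml⟩ := exists_inv_mem_L0pp
    (add_mem_L0pp (add_nonneg hm hm') (one_mem_L0pp P))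
  have hl0 := nonneg_of_mem_L0pp hl
  have hl1 : l ≤ 1 := by
    rw [← hml]
    exact le_mul_of_one_le_left hl0 (le_add_of_nonneg_left (add_nonneg hm hm'))
  have hlm : l * m ≤ 1 := by
    rw [← hml, mul_comm _ l]
    refine mul_le_mul_of_nonneg_left ?_ hl0
    rw [add_assoc]
    exact le_add_of_nonneg_right (add_nonneg hm' zero_le_one)
  have hlm' : l * m' ≤ 1 := by
    rw [← hml, mul_comm _ l]
    refine mul_le_mul_of_nonneg_left ?_ hl0
    rw [add_comm m, add_assoc]
    exact le_add_of_nonneg_right (add_nonneg hm zero_le_one)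
  have hmem : (l * ε) • y ∈ symmSublevel f x (a + 1) := by
    refine ⟨?_, ?_⟩
    · rw [mul_smul]
      exact (epiLE_add_of_epiLE hf ha h1 hl0 hl1).mono (add_le_add_right hlm a)
    · rw [mul_smul, ← smul_neg, ← neg_smul]
      exact (epiLE_add_of_epiLE hf ha h2 hl0 hl1).mono (add_le_add_right hlm' a)
  have hlε := mul_mem_L0pp hl hε
  refine ⟨l * ε, hlε, fun η hη => ?_⟩
  obtain ⟨v, hv, hlv⟩ := exists_inv_mem_L0pp hlε
  have hv0 := nonneg_of_mem_L0pp hv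
  have h := symmSublevel_balanced hf x (a + 1) _ hmem (η * v) (by
    obtain ⟨h1, h2⟩ := abs_le_L0.1 hη
    have h3 := mul_le_mul_of_nonneg_right h1 hv0
    have h4 := mul_le_mul_of_nonneg_right h2 hv0
    rw [hlv] at h4
    rw [neg_mul, hlv] at h3
    exact abs_le_L0.2 ⟨h3, h4⟩)
  rwa [smul_smul, mul_assoc, mul_comm v, hlv, mul_one] at h

theorem symmSublevel_isClosed (hlsc : IsLowerSemicontinuous f) (hE : IsLocallyL0Convex P E)
    (x : E) (r : L0 P) : IsClosed (symmSublevel f x r) := by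
  have hneg : Continuous fun y : E => -y := by
    simpa using hE.continuous_const_smul (-1 : L0 P)
  exact ((hlsc r).preimage (hE.continuous_const_add x)).inter
    ((hlsc r).preimage ((hE.continuous_const_add x).comp hneg))

/-- `f y` may be infinite on part of `Ω`, where nothing is to be shown. Splicing `y` on `{f y ≠ ⊤}`
with `x` elsewhere gives a point of `dom f`, to which `hu` applies. -/
theorem mem_subdifferential_of_forall_epiLE (hproper : IsProper f) (hf : IsL0ConvexFun f) {x : E}
    {a : L0 P} (ha : ∀ᵐ ω ∂P, f x ω = ((a ω : ℝ) : EReal)) {u : E →L[L0 P] L0 P}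
    (hu : ∀ y c, EpiLE f (x + y) (a + c) → u y ≤ c) : u ∈ subdifferential f x := by
  intro y
  have hB : MeasurableSet {ω | f y ω ≠ ⊤} :=
    ((f y).measurable (measurableSet_singleton ⊤)).compl
  set I := ind P hB with hI
  have h1 := hf.ae_le_of_ind_smul_eq hB (x := y) (z := x + I • (y - x)) (by
    rw [smul_add, smul_smul, ← hI, ind_mul_self, smul_sub, add_sub_cancel])
  have h2 := hf.ae_le_of_ind_smul_eq hB.compl (x := x) (z := x + I • (y - x)) (by
    rw [smul_add, smul_smul]
    have : ind P hB.compl * I = 0 := by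
      ext
      filter_upwards [AEEqFun.coeFn_mul (ind P hB.compl) I, coeFn_ind (P := P) hB,
        coeFn_ind (P := P) hB.compl, AEEqFun.coeFn_zero (μ := P) (β := ℝ)] with ω h1 h2 h3 h4
      rw [h1, h4, Pi.mul_apply, h2, h3]
      by_cases h : f y ω = ⊤ <;> simp [h]
    rw [this, zero_smul, add_zero])
  have hdom : x + I • (y - x) ∈ dom f := by
    show ∀ᵐ ω ∂P, _
    filter_upwards [h1, h2, ha, hproper.2 (x + I • (y - x))] with ω h1 h2 h3 h4
    refine ⟨h4.ne', fun h => ?_⟩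
    rw [h] at h1 h2
    by_cases hy : f y ω = ⊤
    · have := h2 (by simpa using hy)
      rw [h3] at this
      exact absurd this (not_le.2 (EReal.coe_lt_top _))
    · exact hy (top_le_iff.1 (h1 hy))
  obtain ⟨c, hc⟩ := exists_coe_of_mem_dom hdom
  have h3 : u (I • (y - x)) ≤ c - a := hu _ _ (by
    rw [add_sub_cancel]
    exact hc.mono fun ω h => h.le)
  rw [map_smul, smul_eq_mul] at h3
  filter_upwards [h1, ha, hc, AEEqFun.coeFn_le.2 h3, AEEqFun.coeFn_sub c a,
    AEEqFun.coeFn_mul I (u (y - x)), coeFn_ind (P := P) hB] with ω h1 h2 h4 h3 e1 e2 e3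
  rw [h2]
  by_cases hy : f y ω = ⊤
  · rw [hy, EReal.top_sub_coe]
    exact le_top
  · have h5 := h1 hy
    rw [e1, e2, Pi.mul_apply, e3, indicator_of_mem hy, one_mul, Pi.sub_apply] at h3
    rw [h4] at h5
    calc ((u (y - x) ω : ℝ) : EReal) ≤ ((c ω - a ω : ℝ) : EReal) := EReal.coe_le_coe_iff.2 h3
      _ = (c ω : EReal) - (a ω : EReal) := EReal.coe_sub _ _
      _ ≤ _ := EReal.sub_le_sub h5 le_rfl

end Subgradient

end RandomConvex

theorem theorem3p45 {Ω : Type*} [MeasurableSpace Ω] (P : MeasureTheory.Measure Ω)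
    [MeasureTheory.IsProbabilityMeasure P]
    {E : Type*} [AddCommGroup E] [Module (RandomConvex.L0 P) E] [TopologicalSpace E]
    (hE_unique : RandomConvex.ConcatenationUnique P E)
    (hE_preBarreled : RandomConvex.IsL0PreBarreled P E)
    (hE_concat : RandomConvex.CountableConcatenation P (Set.univ : Set E))
    (f : E → RandomConvex.L0bar P) (hf_proper : RandomConvex.IsProper f)
    (hf_lsc : RandomConvex.IsLowerSemicontinuous f) (hf_convex : RandomConvex.IsL0ConvexFun f) :
    ∀ x ∈ interior (RandomConvex.dom f), (RandomConvex.subdifferential f x).Nonempty := by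

  intro x hx
  have hE := hE_preBarreled.locallyL0Convex
  obtain ⟨a, ha⟩ := RandomConvex.exists_coe_of_mem_dom (interior_subset hx)
  have habs := RandomConvex.symmSublevel_absorbent hf_convex hE hx (ha.mono fun ω h => h.le)
  have hU := hE_preBarreled.mem_nhds _
    ⟨RandomConvex.symmSublevel_balanced hf_convex x (a + 1), habs,
      RandomConvex.symmSublevel_convex hf_convex x (a + 1),
      RandomConvex.symmSublevel_isClosed hf_lsc hE x (a + 1)⟩
    (RandomConvex.symmSublevel_countableConcatenation hf_convex hE_concat x (a + 1))
  obtain ⟨u, hu⟩ := RandomConvex.exists_linearMap_le_of_absorbent hf_convex ha habs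
  -- The level `a + 1` of the barrel is the case `c = 1` of `hu`, used at `y` and at `-y`.
  have hcont : Continuous u := hE.continuous_of_abs_le_one u hU fun y hy => by
    refine RandomConvex.abs_le_L0.2 ⟨?_, hu y 1 hy.1⟩
    have := hu (-y) 1 hy.2
    rw [map_neg] at this
    exact neg_le.1 this
  exact ⟨⟨u, hcont⟩, RandomConvex.mem_subdifferential_of_forall_epiLE hf_proper hf_convex ha hu⟩
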